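/- Let $G$ be a second countable locally compact topological group, not necessarily Hausdorff, with a right Haar measure $\mu$ (a Borel measure that is invariant under right translations, finite on compact sets and positive on nonempty open sets). Let $a\in G$ be aperiodic, i.e. the closed subgroup $\overline{\langle a\rangle}$ generated by $a$ is not compact. Let $\mathbb K$ be $\mathbb R$ or $\mathbb C$, and write $L^p(G)=L^p(G,\mu;\mathbb K)$. Then there is a bounded continuous function $w:G\to(0,\infty)$ such that for every $p\in[1,\infty)$ the weighted translation $$T_{a,w}:L^p(G)\to L^p(G),\qquad T_{a,w}f(x)=w(x)\,f(xa^{-1}),$$ (a bounded linear operator) is mixing, chaotic and frequently hypercyclic; the same $w$ serves all $p\in[1,\infty)$ simultaneously. Here a bounded linear operator $T$ on a Banach space $X$ is called \begin{itemize} \item mixing if for all nonempty open $U,V\subseteq X$ there is $N\in\mathbb N$ such that $T^nU\cap V\neq\varnothing$ for all $n>N$; \item chaotic if some orbit $\{T^nx: n\in\mathbb N\}$ is dense in $X$ and the set of periodic points $\{x\in X: T^nx=x\text{ for some }n\ge 1\}$ is dense in $X$; \item frequently hypercyclic if there is $x\in X$ such that for every nonempty open $U\subseteq X$ the set $\{n\in\mathbb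 N: T^nx\in U\}$ is infinite and its $k$-th element $n_k$ (in increasing order) satisfies $n_k=O(k)$ as $k\to\infty$. \end{itemize} -/

import Mathlib

open MeasureTheory Filter Topology Asymptotics
open scoped ENNReal BoundedContinuousFunction

/-- An element `a` of a topological group is periodic if the closed subgroup generated by `a`
is compact. -/
def IsPeriodicElement {G : Type*} [Group G] [TopologicalSpace G] [IsTopologicalGroup G]
    (a : G) : Prop :=
  IsCompact ((Subgroup.zpowers a).topologicalClosure : Set G)

/-- An element is aperiodic if it is not periodic. -/
def IsAperiodicElement {G : Type*} [Group G] [TopologicalSpace G] [IsTopologicalGroup G]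
    (a : G) : Prop :=
  ¬ IsPeriodicElement a

/-- A right Haar measure: a right invariant Borel measure that is finite on compact sets and
positive on nonempty open sets. (On a second countable locally compact group such a measure is
automatically regular.) -/
class IsRightHaarMeasure {G : Type*} [Group G] [TopologicalSpace G] [MeasurableSpace G]
    (μ : Measure G) : Prop
    extends IsFiniteMeasureOnCompacts μ, μ.IsMulRightInvariant, μ.IsOpenPosMeasure

section Dynamics

variable {𝕜 X : Type*} [NormedField 𝕜] [NormedAddCommGroup X] [NormedSpace 𝕜 X]

/-- Some orbit `{Tⁿ x | n ∈ ℕ}` is dense. -/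
def IsHypercyclicOp (T : X →L[𝕜] X) : Prop :=
  ∃ x : X, Dense (Set.range fun n : ℕ => (T ^ n) x)

/-- For all nonempty open `U`, `V`, the sets `Tⁿ U` and `V` meet for all large `n`. -/
def IsMixingOp (T : X →L[𝕜] X) : Prop :=
  ∀ U V : Set X, IsOpen U → IsOpen V → U.Nonempty → V.Nonempty →
    ∃ N : ℕ, ∀ n : ℕ, N < n → (((T ^ n) '' U) ∩ V).Nonempty

/-- Hypercyclic with a dense set of periodic points. -/
def IsChaoticOp (T : X →L[𝕜] X) : Prop :=
  IsHypercyclicOp T ∧ Dense {x : X | ∃ n : ℕ, 0 < n ∧ (T ^ n) x = x}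

/-- There is a vector `x` such that, for each nonempty open `U`, the return times
`{m | Tᵐ x ∈ U}` are enumerated by a strictly increasing sequence `n` with `n k = O(k)`. -/
def IsFrequentlyHypercyclicOp (T : X →L[𝕜] X) : Prop :=
  ∃ x : X, ∀ U : Set X, IsOpen U → U.Nonempty →
    ∃ n : ℕ → ℕ, StrictMono n ∧ Set.range n = {m : ℕ | (T ^ m) x ∈ U} ∧
      (fun k : ℕ => (n k : ℝ)) =O[atTop] (fun k : ℕ => (k : ℝ))

end Dynamics

section WeightedTranslation

variable {G : Type*} [Group G] [TopologicalSpace G] [IsTopologicalGroup G]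
  [MeasurableSpace G] [BorelSpace G]
  (𝕜 : Type*) [RCLike 𝕜] (μ : Measure G) [IsRightHaarMeasure μ] (p : ℝ≥0∞)

theorem memLp_weightedTranslation (a : G) (w : G →ᵇ ℝ) (f : Lp 𝕜 p μ) :
    MemLp (fun x => (w x : 𝕜) * f (x * a⁻¹)) p μ := by
  have h1 : MemLp (fun x => f (x * a⁻¹)) p μ :=
    (Lp.memLp f).comp_measurePreserving (measurePreserving_mul_right μ a⁻¹)
  have h2 : AEStronglyMeasurable (fun x => (w x : 𝕜)) μ :=
    (RCLike.continuous_ofReal.comp w.continuous).aestronglyMeasurable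
  refine h1.of_le_mul (c := ‖w‖) (h2.mul h1.1) (Eventually.of_forall fun x => ?_)
  rw [norm_mul, RCLike.norm_ofReal]
  exact mul_le_mul_of_nonneg_right (w.norm_coe_le_norm x) (norm_nonneg _)

/-- The weighted translation operator `T_{a,w} f (x) = w x * f (x * a⁻¹)` on `L^p(G)`, for a
bounded continuous function `w`. -/
noncomputable def weightedTranslation [Fact (1 ≤ p)] (a : G) (w : G →ᵇ ℝ) :
    Lp 𝕜 p μ →L[𝕜] Lp 𝕜 p μ :=
  LinearMap.mkContinuous
    { toFun := fun f => (memLp_weightedTranslation 𝕜 μ p a w f).toLp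
        (fun x => (w x : 𝕜) * f (x * a⁻¹))
      map_add' := fun f g => by
        rw [← MemLp.toLp_add]
        apply MemLp.toLp_congr
        filter_upwards [(measurePreserving_mul_right μ a⁻¹).quasiMeasurePreserving.ae
          (Lp.coeFn_add f g)] with x hx
        simp only [Pi.add_apply] at hx ⊢
        rw [hx, mul_add]
      map_smul' := fun c f => by
        rw [RingHom.id_apply, ← MemLp.toLp_const_smul]
        apply MemLp.toLp_congr
        filter_upwards [(measurePreserving_mul_right μ a⁻¹).quasiMeasurePreserving.ae
          (Lp.coeFn_smul c f)] with x hx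
        simp only [Pi.smul_apply, smul_eq_mul] at hx ⊢
        rw [hx]
        ring }
    ‖w‖
    (fun f => by
      have h0 := measurePreserving_mul_right μ a⁻¹
      have h1 : ‖Lp.compMeasurePreserving (fun x => x * a⁻¹) h0 f‖ = ‖f‖ :=
        Lp.norm_compMeasurePreserving f h0
      rw [← h1]
      apply Lp.norm_le_mul_norm_of_ae_le_mul
      filter_upwards [Lp.coeFn_compMeasurePreserving f h0,
        MemLp.coeFn_toLp (memLp_weightedTranslation 𝕜 μ p a w f)] with x hx hx'
      rw [hx]
      refine (congrArg norm hx').trans_le ?_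
      rw [norm_mul, RCLike.norm_ofReal]
      exact mul_le_mul_of_nonneg_right (w.norm_coe_le_norm x) (norm_nonneg _))

theorem coeFn_weightedTranslation [Fact (1 ≤ p)] (a : G) (w : G →ᵇ ℝ) (f : Lp 𝕜 p μ) :
    weightedTranslation 𝕜 μ p a w f =ᵐ[μ] fun x => (w x : 𝕜) * f (x * a⁻¹) :=
  MemLp.coeFn_toLp (memLp_weightedTranslation 𝕜 μ p a w f)

end WeightedTranslation

/-! Write `w x = h x / h (x * a⁻¹)` with `h > 0` continuous. Multiplication by `h` then formally
conjugates the plain translation to `T`, so a continuous compactly supported `g` has the bi-infinite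
orbit `h · (g / h)(· a⁻ⁿ)`. If `h (x * a ^ n)` is summable in `n`, uniformly on compact sets, these
orbits have summable `Lᵖ` norms, and such `g` are dense for every finite `p`; `h` does not depend on
`p`.

A dense set of vectors with summable orbits yields all the dynamics: mixing by superposing two
orbits, periodic points by summing one orbit along an arithmetic progression, and frequent
hypercyclicity by summing backward iterates over well-separated sets of times.

Aperiodicity supplies `h`: a compact set is disjoint from its translates by large powers of `a`, so
a series of small bumps decays along orbits. Averaging it along the orbit bounds the quotient. -/

/-! ### Tails of norm-summable bi-infinite sequences. -/

section Tail

variable {X : Type*} [NormedAddCommGroup X]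

/-- The sum of the norms `‖u k‖` over the integers `k` with `N ≤ |k|`. -/
noncomputable def normTail (u : ℤ → X) (N : ℕ) : ℝ≥0∞ :=
  ∑' k : ℤ, if N ≤ k.natAbs then ‖u k‖ₑ else 0

theorem normTail_antitone (u : ℤ → X) : Antitone (normTail u) := by
  intro M N h
  refine ENNReal.tsum_le_tsum fun k => ?_
  split_ifs with h1 h2
  · exact le_rfl
  · exact absurd (h.trans h1) h2
  · exact zero_le
  · exact le_rfl

theorem tendsto_normTail {u : ℤ → X} (hu : Summable fun n => ‖u n‖) :
    Tendsto (normTail u) atTop (𝓝 0) := by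
  rw [ENNReal.tendsto_nhds_zero]
  intro ε hε
  have h1 := ENNReal.tendsto_tsum_compl_atTop_zero (tsum_enorm_ne_top_iff_summable_norm.2 hu)
  obtain ⟨s, hs⟩ := (ENNReal.tendsto_nhds_zero.1 h1 ε hε).exists
  filter_upwards [eventually_gt_atTop (s.sup Int.natAbs)] with N hN
  refine le_trans ?_ hs
  refine le_trans ?_ (tsum_subtype (s : Set ℤ)ᶜ fun b => ‖u b‖ₑ).ge
  refine ENNReal.tsum_le_tsum fun k => ?_
  split_ifs with h2
  · rw [Set.indicator_of_mem]
    intro hk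
    exact absurd (Finset.le_sup (f := Int.natAbs) hk) (by omega)
  · exact zero_le

/-- A sum of norms of terms `u (e i)`, with distinct indices of absolute value at least `N`, is
bounded by the tail. -/
theorem tsum_enorm_le_normTail {ι : Type*} {u : ℤ → X} {N : ℕ} {e : ι → ℤ}
    (he : Function.Injective e) (P : ι → Prop) [DecidablePred P]
    (hP : ∀ i, P i → N ≤ (e i).natAbs) :
    ∑' i, ‖if P i then u (e i) else 0‖ₑ ≤ normTail u N := by
  refine le_trans (ENNReal.tsum_le_tsum fun i => ?_) (ENNReal.tsum_comp_le_tsum_of_injective he _)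
  split_ifs with h1 h2 h2
  · exact le_rfl
  · exact absurd (hP i h1) h2
  · simp
  · simp

end Tail

/-! ### Mixing and periodic points from summable orbits. -/

section Criterion

variable {𝕜 X : Type*} [NormedField 𝕜] [NormedAddCommGroup X] [NormedSpace 𝕜 X]

/-- The vector `x` lies on a bi-infinite orbit of `T` whose norms are summable. -/
def HasSummableOrbit (T : X →L[𝕜] X) (x : X) : Prop :=
  ∃ u : ℤ → X, u 0 = x ∧ (∀ n, T (u n) = u (n + 1)) ∧ Summable fun n => ‖u n‖

theorem pow_apply_orbit {T : X →L[𝕜] X} {u : ℤ → X} (hu : ∀ n, T (u n) = u (n + 1)) (m : ℕ)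
    (n : ℤ) : (T ^ m) (u n) = u (n + m) := by
  induction m with
  | zero => simp
  | succ m ih =>
    rw [pow_succ', mul_apply_eq_comp, ih, hu]
    congr 1
    push_cast
    ring

/-- The vector `u 0 + v (-n)` is close to `u 0`, and `T ^ n` sends it to `u n + v 0`, which is close
to `v 0`. -/
theorem isMixingOp_of_dense_summableOrbit {T : X →L[𝕜] X}
    (hD : Dense {x | HasSummableOrbit T x}) : IsMixingOp T := by
  intro U V hU hV hUn hVn
  obtain ⟨x, hxU, u, rfl, hu, hus⟩ := hD.inter_open_nonempty U hU hUn
  obtain ⟨y, hyV, v, rfl, hv, hvs⟩ := hD.inter_open_nonempty V hV hVn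
  have h1 : Tendsto (fun n : ℕ => u 0 + v (-(n : ℤ))) atTop (𝓝 (u 0)) := by
    have h := (tendsto_zero_iff_norm_tendsto_zero.2 hvs.tendsto_cofinite_zero).comp
      (neg_injective.comp Nat.cast_injective : Function.Injective fun n : ℕ => -(n : ℤ)).tendsto_cofinite
    rw [Nat.cofinite_eq_atTop] at h
    simpa using h.const_add (u 0)
  have h2 : Tendsto (fun n : ℕ => u n + v 0) atTop (𝓝 (v 0)) := by
    have h := (tendsto_zero_iff_norm_tendsto_zero.2 hus.tendsto_cofinite_zero).comp
      (Nat.cast_injective : Function.Injective fun n : ℕ => (n : ℤ)).tendsto_cofinite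
    rw [Nat.cofinite_eq_atTop] at h
    simpa using h.add_const (v 0)
  obtain ⟨N, hN⟩ := eventually_atTop.1
    ((h1.eventually (hU.mem_nhds hxU)).and (h2.eventually (hV.mem_nhds hyV)))
  refine ⟨N, fun n hn => ⟨u n + v 0, ⟨_, (hN n hn.le).1, ?_⟩, (hN n hn.le).2⟩⟩
  rw [map_add, pow_apply_orbit hu, pow_apply_orbit hv]
  simp

/-- `T ^ (N + 1)` only reindexes `∑ u (k (N + 1))`, so this sum is periodic; its terms with `k ≠ 0`
lie in the tail beyond `N`. -/
theorem dense_periodicPts_of_dense_summableOrbit [CompleteSpace X] {T : X →L[𝕜] X}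
    (hD : Dense {x | HasSummableOrbit T x}) : Dense {x : X | ∃ n : ℕ, 0 < n ∧ (T ^ n) x = x} := by
  refine dense_closure.1 (hD.mono ?_)
  rintro _ ⟨u, rfl, hu, hus⟩
  have hinj : ∀ N : ℕ, Function.Injective fun k : ℤ => k * ((N + 1 : ℕ) : ℤ) := fun N =>
    mul_left_injective₀ (by exact_mod_cast N.succ_ne_zero)
  have hsum : ∀ N : ℕ, Summable fun k : ℤ => u (k * ((N + 1 : ℕ) : ℤ)) := fun N =>
    hus.of_norm.comp_injective (hinj N)
  have hlim : Tendsto (fun N : ℕ => ∑' k : ℤ, u (k * ((N + 1 : ℕ) : ℤ))) atTop (𝓝 (u 0)) := by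
    rw [tendsto_iff_edist_tendsto_0]
    refine tendsto_of_tendsto_of_tendsto_of_le_of_le tendsto_const_nhds
      (tendsto_normTail hus) (fun _ => zero_le) fun N => ?_
    have h := (hsum N).tsum_eq_add_tsum_ite 0
    simp only [zero_mul] at h
    simp only [edist_eq_enorm_sub, h, add_sub_cancel_left]
    refine (enorm_tsum_le_tsum_enorm).trans ?_
    have := tsum_enorm_le_normTail (u := u) (N := N) (hinj N) (fun k => k ≠ 0) (fun k hk => by
      rw [Int.natAbs_mul, Int.natAbs_natCast]
      nlinarith [Int.natAbs_pos.2 hk])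
    simpa only [ite_not] using this
  refine mem_closure_of_tendsto hlim (Eventually.of_forall fun N => ⟨N + 1, N.succ_pos, ?_⟩)
  rw [ContinuousLinearMap.map_tsum _ (hsum N)]
  refine Eq.trans ?_ ((Equiv.addRight (1 : ℤ)).tsum_eq _)
  refine tsum_congr fun k => ?_
  rw [pow_apply_orbit hu]
  congr 1
  simp [add_mul]

end Criterion

/-! ### Separated sets of positive lower density. -/

section SeparatedSets

/-- A set `E` of natural numbers has more than `k` elements below `C * k`, for some `C` and all
`k ≥ 1`. This amounts to positive lower density. -/
def HasLinearCount (E : Set ℕ) : Prop :=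
  ∃ C : ℕ, ∀ k : ℕ, 0 < k → ∃ s : Finset ℕ, k < s.card ∧ ∀ n ∈ s, n ∈ E ∧ n < C * k

theorem HasLinearCount.mono {E F : Set ℕ} (h : HasLinearCount E) (hEF : E ⊆ F) :
    HasLinearCount F := by
  obtain ⟨C, hC⟩ := h
  refine ⟨C, fun k hk => ?_⟩
  obtain ⟨s, hs, hs'⟩ := hC k hk
  exact ⟨s, hs, fun n hn => ⟨hEF (hs' n hn).1, (hs' n hn).2⟩⟩

theorem HasLinearCount.infinite {E : Set ℕ} (h : HasLinearCount E) : E.Infinite := by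
  obtain ⟨C, hC⟩ := h
  intro hfin
  obtain ⟨s, hs, hs'⟩ := hC (hfin.toFinset.card + 1) (Nat.succ_pos _)
  have : s.card ≤ hfin.toFinset.card :=
    Finset.card_le_card fun n hn => hfin.mem_toFinset.2 (hs' n hn).1
  omega

theorem HasLinearCount.exists_enumeration {E : Set ℕ} (h : HasLinearCount E) :
    ∃ n : ℕ → ℕ, StrictMono n ∧ Set.range n = E ∧
      (fun k : ℕ => (n k : ℝ)) =O[atTop] (fun k : ℕ => (k : ℝ)) := by
  classical
  refine ⟨Nat.nth (· ∈ E), Nat.nth_strictMono h.infinite, Nat.range_nth_of_infinite h.infinite, ?_⟩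
  obtain ⟨C, hC⟩ := h
  refine IsBigO.of_bound C ?_
  filter_upwards [eventually_gt_atTop 0] with k hk
  obtain ⟨s, hs, hs'⟩ := hC k hk
  have h1 : Nat.nth (· ∈ E) k < C * k := by
    refine Nat.nth_lt_of_lt_count (hs.trans_le ?_)
    rw [Nat.count_eq_card_filter_range]
    exact Finset.card_le_card fun n hn =>
      Finset.mem_filter.2 ⟨Finset.mem_range.2 (hs' n hn).2, (hs' n hn).1⟩
  simp only [Real.norm_natCast]
  exact_mod_cast h1.le

/-- Pairwise disjoint sets of linear growth whose elements are far from zero and from each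
other. -/
theorem exists_separated_hasLinearCount (q : ℕ → ℕ) : ∃ E : ℕ → Set ℕ,
    (∀ j, HasLinearCount (E j)) ∧ (∀ j, ∀ n ∈ E j, q j ≤ n) ∧
    (∀ i j n, n ∈ E i → n ∈ E j → i = j) ∧
    ∀ i j, ∀ m ∈ E i, ∀ n ∈ E j, m ≠ n → max (q i) (q j) ≤ ((m : ℤ) - n).natAbs := by
  -- The 2-adic valuation of the exponent `s` labels the block `[2 ^ s, 3 · 2 ^ (s - 1))` with `j`.
  -- Different blocks are far apart, and within a block only multiples of `2 ^ q j` are kept.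
  let B : ℕ → ℕ → ℕ → Prop := fun j s n =>
    (∃ t, s = 2 ^ j * (2 * t + 1)) ∧ q j + 3 ≤ s ∧ 2 ^ s ≤ n ∧ n < 2 ^ s + 2 ^ (s - 1) ∧ 2 ^ q j ∣ n
  have hlab : ∀ i j s, (∃ t, s = 2 ^ i * (2 * t + 1)) → (∃ t, s = 2 ^ j * (2 * t + 1)) → i = j := by
    have key : ∀ i j t r : ℕ, i < j → 2 ^ i * (2 * t + 1) ≠ 2 ^ j * (2 * r + 1) := by
      intro i j t r hij h
      obtain ⟨d, rfl⟩ := Nat.exists_eq_add_of_lt hij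
      rw [show i + d + 1 = i + (d + 1) by ring, pow_add, mul_assoc] at h
      have := Nat.eq_of_mul_eq_mul_left (by positivity) h
      rw [pow_succ, mul_comm (2 ^ d) 2, mul_assoc] at this
      omega
    rintro i j s ⟨t, rfl⟩ ⟨r, hr⟩
    rcases lt_trichotomy i j with h | h | h
    · exact absurd hr (key _ _ _ _ h)
    · exact h
    · exact absurd hr.symm (key _ _ _ _ h)
  have hfar : ∀ i j s r m n, B i s m → B j r n → s < r →
      max (q i) (q j) ≤ ((m : ℤ) - n).natAbs := by
    rintro i j s r m n ⟨-, h1, h2, h3, -⟩ ⟨-, k1, k2, k3, -⟩ hsr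
    obtain ⟨d, rfl⟩ : ∃ d, r = d + 3 := ⟨r - 3, by omega⟩
    obtain ⟨c, rfl⟩ : ∃ c, s = c + 3 := ⟨s - 3, by omega⟩
    have hcd : 2 ^ (c + 1) ≤ 2 ^ d := Nat.pow_le_pow_right (by norm_num) (by omega)
    have hd : d < 2 ^ d := Nat.lt_two_pow_self
    simp only [show c + 3 - 1 = c + 2 by omega, pow_succ] at *
    have : max (q i) (q j) ≤ d := max_le (by omega) (by omega)
    omega
  have hnear : ∀ i j s m n, B i s m → B j s n → m ≠ n →
      max (q i) (q j) ≤ ((m : ℤ) - n).natAbs := by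
    rintro i j s m n ⟨h0, -, -, -, h1⟩ ⟨k0, -, -, -, k1⟩ hmn
    obtain rfl := hlab _ _ _ h0 k0
    rw [max_self]
    have hdvd : ((2 ^ q i : ℕ) : ℤ) ∣ (m : ℤ) - n :=
      dvd_sub (Int.natCast_dvd_natCast.2 h1) (Int.natCast_dvd_natCast.2 k1)
    have := Nat.le_of_dvd (Int.natAbs_pos.2 (by omega)) (Int.natCast_dvd.1 hdvd)
    exact Nat.lt_two_pow_self.le.trans this
  refine ⟨fun j => {n | ∃ s, B j s n}, fun j => ?_, ?_, ?_, ?_⟩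
  -- Exponents with label `j` recur every `2 ^ (j + 1)`, so one lies just above `log2 k + q j + 3`;
  -- its block already holds `k + 1` multiples of `2 ^ q j`.
  · refine ⟨2 ^ (q j + 4 + 2 ^ (j + 2)), fun k hk => ?_⟩
    obtain ⟨L, hL⟩ : ∃ L, L = Nat.log2 k + q j + 3 := ⟨_, rfl⟩
    obtain ⟨s, hs, hs1, hs2⟩ : ∃ s, (∃ t, s = 2 ^ j * (2 * t + 1)) ∧ L ≤ s ∧ s ≤ L + 2 ^ (j + 2) := by
      refine ⟨_, ⟨L / 2 ^ (j + 1) + 1, rfl⟩, ?_⟩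
      have h1 := Nat.div_add_mod L (2 ^ (j + 1))
      have h2 := Nat.mod_lt L (show 0 < 2 ^ (j + 1) by positivity)
      have h3 : 2 ^ j * (2 * (L / 2 ^ (j + 1) + 1) + 1) =
        2 ^ (j + 1) * (L / 2 ^ (j + 1)) + 3 * 2 ^ j := by ring
      rw [h3]
      have h4 : 2 ^ (j + 1) = 2 * 2 ^ j := by ring
      have h5 : 2 ^ (j + 2) = 4 * 2 ^ j := by ring
      omega
    have hk1 : 2 ^ Nat.log2 k ≤ k := Nat.log2_self_le hk.ne'
    have hk2 : k < 2 ^ (Nat.log2 k + 1) := Nat.lt_log2_self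
    refine ⟨(Finset.range (k + 1)).image fun i => 2 ^ s + i * 2 ^ q j, ?_, ?_⟩
    · rw [Finset.card_image_of_injective, Finset.card_range]
      · exact Nat.lt_succ_self k
      · intro m n hmn
        exact Nat.eq_of_mul_eq_mul_right (show 0 < 2 ^ q j by positivity) (Nat.add_left_cancel hmn)
    · intro n hn
      obtain ⟨i, hi, rfl⟩ := Finset.mem_image.1 hn
      have hi' : i < 2 ^ (Nat.log2 k + 1) :=
        (Nat.lt_succ_iff.1 (Finset.mem_range.1 hi)).trans_lt hk2
      have h1 : i * 2 ^ q j < 2 ^ (s - 1) :=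
        calc i * 2 ^ q j < 2 ^ (Nat.log2 k + 1) * 2 ^ q j :=
              Nat.mul_lt_mul_of_pos_right hi' (by positivity)
          _ = 2 ^ (Nat.log2 k + 1 + q j) := (pow_add _ _ _).symm
          _ ≤ 2 ^ (s - 1) := Nat.pow_le_pow_right (by norm_num) (by omega)
      refine ⟨⟨s, hs, by omega, Nat.le_add_right _ _, by omega, ?_⟩, ?_⟩
      · exact dvd_add (pow_dvd_pow 2 (by omega)) (dvd_mul_left _ _)
      · have h2 : 2 ^ (s - 1) ≤ 2 ^ s := Nat.pow_le_pow_right (by norm_num) (by omega)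
        calc 2 ^ s + i * 2 ^ q j < 2 ^ (s + 1) := by rw [pow_succ]; omega
          _ ≤ 2 ^ (q j + 4 + 2 ^ (j + 2) + Nat.log2 k) :=
              Nat.pow_le_pow_right (by norm_num) (by omega)
          _ ≤ 2 ^ (q j + 4 + 2 ^ (j + 2)) * k := by rw [pow_add]; gcongr
  · rintro j n ⟨s, -, h1, h2, -⟩
    have : s < 2 ^ s := Nat.lt_two_pow_self
    omega
  · rintro i j n ⟨s, hs⟩ ⟨r, hr⟩
    have : s = r := by
      have aux : ∀ i j s r, B i s n → B j r n → ¬ s < r := by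
        rintro i j s r ⟨-, h1, h2, h3, -⟩ ⟨-, k1, k2, k3, -⟩ hsr
        obtain ⟨c, rfl⟩ : ∃ c, s = c + 1 := ⟨s - 1, by omega⟩
        have := Nat.pow_le_pow_right (n := 2) (by norm_num) hsr
        simp only [Nat.add_sub_cancel, pow_succ] at *
        omega
      exact le_antisymm (not_lt.1 (aux j i r s hr hs)) (not_lt.1 (aux i j s r hs hr))
    subst this
    exact hlab _ _ _ hs.1 hr.1
  · rintro i j m ⟨s, hs⟩ n ⟨r, hr⟩ hmn
    rcases lt_trichotomy s r with h | rfl | h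
    · exact hfar _ _ _ _ _ _ hs hr h
    · exact hnear _ _ _ _ _ hs hr hmn
    · rw [max_comm, ← Int.natAbs_neg, neg_sub]
      exact hfar _ _ _ _ _ _ hr hs h

end SeparatedSets

/-! ### Frequent hypercyclicity from summable orbits. -/

section FrequentHypercyclicity

variable {𝕜 X : Type*} [NormedField 𝕜] [NormedAddCommGroup X] [NormedSpace 𝕜 X]

theorem IsFrequentlyHypercyclicOp.isHypercyclicOp {T : X →L[𝕜] X}
    (h : IsFrequentlyHypercyclicOp T) : IsHypercyclicOp T := by
  obtain ⟨x, hx⟩ := h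
  refine ⟨x, dense_iff_inter_open.2 fun U hU hUn => ?_⟩
  obtain ⟨n, -, hn, -⟩ := hx U hU hUn
  have h0 : n 0 ∈ {m : ℕ | (T ^ m) x ∈ U} := hn ▸ Set.mem_range_self 0
  exact ⟨_, h0, n 0, rfl⟩

/-- The squared factor lets the tail beyond `max (q i) (q j)` be bounded by `2⁻ʲ 2⁻ⁱ`, which is
summable in `i` and small in `j`. -/
theorem exists_normTail_le (u : ℕ → ℤ → X) (hu : ∀ j, Summable fun n => ‖u j n‖) :
    ∃ q : ℕ → ℕ, ∀ j, ∀ i ≤ j, normTail (u i) (q j) ≤ (2⁻¹ : ℝ≥0∞) ^ j * 2⁻¹ ^ j := by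
  have h : ∀ j : ℕ, ∃ q, ∀ i ∈ Set.Iic j, normTail (u i) q ≤ (2⁻¹ : ℝ≥0∞) ^ j * 2⁻¹ ^ j := by
    intro j
    refine Eventually.exists (f := atTop) ?_
    rw [eventually_all_finite (Set.finite_Iic j)]
    intro i _
    exact ENNReal.tendsto_nhds_zero.1 (tendsto_normTail (hu i)) _
      (pos_iff_ne_zero.2 (by simp))
  choose q hq using h
  exact ⟨q, fun j i hi => hq j i hi⟩

/-- Take `x = ∑ u i (-n)` over all `i` and `n ∈ E i`. For `m ∈ E j`, the term `(j, m)` of `T ^ m x`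
is `u j 0`; the others are `u i (m - n)` with `|m - n| ≥ max (q i) (q j)`, so they fall in the
tails. -/
theorem exists_approximate_returns [CompleteSpace X] {T : X →L[𝕜] X} (u : ℕ → ℤ → X)
    (hT : ∀ j n, T (u j n) = u j (n + 1)) (hu : ∀ j, Summable fun n => ‖u j n‖) :
    ∃ (x : X) (E : ℕ → Set ℕ), (∀ j, HasLinearCount (E j)) ∧
      ∀ j, ∀ m ∈ E j, edist ((T ^ m) x) (u j 0) ≤ (2⁻¹ : ℝ≥0∞) ^ j * 2 := by
  classical
  obtain ⟨q, hq⟩ := exists_normTail_le u hu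
  obtain ⟨E, hE, hE0, hEd, hEs⟩ := exists_separated_hasLinearCount q
  have hq' : ∀ i j, normTail (u i) (max (q i) (q j)) ≤ (2⁻¹ : ℝ≥0∞) ^ j * 2⁻¹ ^ i := by
    intro i j
    have hle : ∀ {a b : ℕ}, a ≤ b → (2⁻¹ : ℝ≥0∞) ^ b ≤ 2⁻¹ ^ a := fun h =>
      pow_le_pow_of_le_one zero_le (by simp) h
    rcases le_total i j with h | h
    · refine (normTail_antitone _ (le_max_right _ _)).trans ((hq j i h).trans ?_)
      exact mul_le_mul_right (hle h) _
    · refine (normTail_antitone _ (le_max_left _ _)).trans ((hq i i le_rfl).trans ?_)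
      exact mul_le_mul_left (hle h) _
  have hgeom : ∑' i : ℕ, (2⁻¹ : ℝ≥0∞) ^ i = 2 := by
    rw [ENNReal.tsum_geometric, ENNReal.one_sub_inv_two, inv_inv]
  set F : ℕ × ℕ → X := fun z => if z.2 ∈ E z.1 then u z.1 (-(z.2 : ℤ)) else 0 with hF
  have hFs : Summable F := by
    refine Summable.of_enorm (ne_top_of_le_ne_top (b := 2) (by simp) ?_)
    rw [ENNReal.tsum_prod']
    rw [← hgeom]
    refine ENNReal.tsum_le_tsum fun i => ?_
    refine (tsum_enorm_le_normTail (N := q i) (neg_injective.comp Nat.cast_injective)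
      (fun n => n ∈ E i) fun n hn => ?_).trans ((hq i i le_rfl).trans ?_)
    · simpa using hE0 i n hn
    · exact mul_le_of_le_one_right zero_le (pow_le_one₀ zero_le (by simp))
  refine ⟨∑' z, F z, E, hE, fun j m hm => ?_⟩
  have hsum := ((T ^ m).summable hFs).tsum_eq_add_tsum_ite (j, m)
  have hval : (T ^ m) (F (j, m)) = u j 0 := by
    simp only [hF, hm, if_true]
    rw [pow_apply_orbit (hT j), neg_add_cancel]
  rw [edist_eq_enorm_sub, ContinuousLinearMap.map_tsum _ hFs, hsum, hval, add_sub_cancel_left]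
  refine enorm_tsum_le_tsum_enorm.trans ?_
  refine le_of_le_of_eq ?_ (congrArg ((2⁻¹ : ℝ≥0∞) ^ j * ·) hgeom)
  rw [ENNReal.tsum_prod', ← ENNReal.tsum_mul_left]
  refine ENNReal.tsum_le_tsum fun i => le_trans (le_of_eq (tsum_congr fun n => ?_))
    ((tsum_enorm_le_normTail (u := u i) (N := max (q i) (q j)) (e := fun n : ℕ => (m : ℤ) - n)
      (sub_right_injective.comp Nat.cast_injective)
      (fun n => n ∈ E i ∧ n ≠ m) fun n hn => ?_).trans (hq' i j))
  · congr 1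
    by_cases h1 : n ∈ E i
    · by_cases h2 : n = m
      -- Disjointness forces `i = j`, so this is the main term already removed.
      · subst h2
        simp [hEd i j n h1 hm]
      · simp only [hF, h1, h2, if_true, Prod.mk.injEq, and_false, if_false, ne_eq,
          not_false_eq_true, and_self]
        rw [pow_apply_orbit (hT i), neg_add_eq_sub]
    · simp [hF, h1]
  · rw [max_comm]
    exact hEs j i m hm n hn.1 hn.2.symm

/-- Through `Nat.unpair` each vector of a dense sequence is repeated at arbitrarily large indices,
where the return error is as small as desired. -/
theorem isFrequentlyHypercyclicOp_of_dense_summableOrbit [CompleteSpace X]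
    [SecondCountableTopology X] {T : X →L[𝕜] X}
    (hD : Dense {x | HasSummableOrbit T x}) : IsFrequentlyHypercyclicOp T := by
  have : Nonempty {x | HasSummableOrbit T x} := hD.nonempty.to_subtype
  obtain ⟨d, hd⟩ := TopologicalSpace.exists_dense_seq {x | HasSummableOrbit T x}
  have hd' : DenseRange fun i => (d i : X) := hD.denseRange_val.comp hd continuous_subtype_val
  choose u hu0 hT hu using fun j : ℕ => (d j.unpair.1).2
  obtain ⟨x, E, hE, hx⟩ := exists_approximate_returns u hT hu
  refine ⟨x, fun U hU hUn => HasLinearCount.exists_enumeration ?_⟩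
  obtain ⟨i, hi⟩ := hd'.exists_mem_open hU hUn
  obtain ⟨ε, hε, hεU⟩ := EMetric.mem_nhds_iff.1 (hU.mem_nhds hi)
  have hlim : Tendsto (fun b : ℕ => (2⁻¹ : ℝ≥0∞) ^ b * 2) atTop (𝓝 0) := by
    have h := ENNReal.Tendsto.mul_const
      (ENNReal.tendsto_pow_atTop_nhds_zero_of_lt_one (r := (2⁻¹ : ℝ≥0∞)) (by simp))
      (Or.inr (by simp : (2 : ℝ≥0∞) ≠ ∞))
    simpa using h
  obtain ⟨b, hb⟩ := (hlim.eventually (gt_mem_nhds hε)).exists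
  refine (hE (Nat.pair i b)).mono fun m hm => hεU ?_
  have h := hx _ m hm
  rw [hu0, Nat.unpair_pair] at h
  refine lt_of_le_of_lt (h.trans ?_) hb
  gcongr ?_ * 2
  exact pow_le_pow_of_le_one zero_le (by simp) (Nat.right_le_pair i b)

end FrequentHypercyclicity

/-! ### Powers of an aperiodic element leave compact sets. -/

section Aperiodic

open scoped Pointwise

variable {G : Type*} [Group G] [TopologicalSpace G] [IsTopologicalGroup G]

/-- If the powers of `a` return infinitely often to a compact set, then they return infinitely
often to every neighbourhood of the identity. -/
theorem exists_pow_mem_nhds_one {a : G} {C : Set G} (hC : IsCompact C)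
    (h : ∃ᶠ n : ℕ in atTop, a ^ n ∈ C) {W : Set G} (hW : W ∈ 𝓝 (1 : G)) (N : ℕ) :
    ∃ n, N ≤ n ∧ a ^ n ∈ W := by
  -- Two powers close to the same cluster point have a quotient close to `1`, and their exponents
  -- can be taken far apart.
  obtain ⟨y, -, hy⟩ := hC.exists_mapClusterPt_of_frequently h
  have hcont : Tendsto (fun z : G × G => z.1⁻¹ * z.2) (𝓝 (y, y)) (𝓝 1) := by
    have : Continuous fun z : G × G => z.1⁻¹ * z.2 := by fun_prop
    simpa using this.tendsto (y, y)
  have hW' := hcont hW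
  rw [nhds_prod_eq, mem_map, mem_prod_self_iff] at hW'
  obtain ⟨V, hV, hVW⟩ := hW'
  have hf := mapClusterPt_iff_frequently.1 hy V hV
  obtain ⟨m, hm⟩ := hf.exists
  obtain ⟨n, hn, hn'⟩ := frequently_atTop.1 hf (m + N)
  refine ⟨n - m, by omega, ?_⟩
  have := hVW (Set.mk_mem_prod hm hn')
  rwa [Set.mem_preimage, ← zpow_natCast, ← zpow_natCast, ← zpow_neg, ← zpow_add,
    show -(m : ℤ) + n = ((n - m : ℕ) : ℤ) by omega, zpow_natCast] at this

/-- Some positive power of `a` carries each point of `F ∩ closure ⟨a⟩` back into `F`, and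
compactness bounds the exponents needed. Return times to `F` are thus bounded, so finitely many
translates of `F` cover all powers of `a`. -/
theorem isPeriodicElement_of_frequently_mem [LocallyCompactSpace G] {a : G} {C : Set G}
    (hC : IsCompact C) (h : ∃ᶠ n : ℕ in atTop, a ^ n ∈ C) : IsPeriodicElement a := by
  obtain ⟨F, hF, hF1⟩ := exists_compact_mem_nhds (1 : G)
  obtain ⟨V, hVo, hV1, hVF⟩ := exists_open_nhds_one_mul_subset hF1
  have hK : IsCompact (F ∩ closure (Set.range fun k : ℤ => a ^ k)) := hF.inter_right isClosed_closure
  have hcover : F ∩ closure (Set.range fun k : ℤ => a ^ k) ⊆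
      ⋃ m : ℕ, (fun x => a ^ (m + 1) * x) ⁻¹' (V * V) := by
    rintro x ⟨-, hx⟩
    have hx' : (fun y => y⁻¹ * x) ⁻¹' V ∈ 𝓝 x := by
      have : Continuous fun y : G => y⁻¹ * x := by fun_prop
      exact this.continuousAt.preimage_mem_nhds (by simpa using hVo.mem_nhds hV1)
    obtain ⟨_, hj, j, rfl⟩ := mem_closure_iff_nhds.1 hx _ hx'
    obtain ⟨n, hn, hnV⟩ := exists_pow_mem_nhds_one hC h (hVo.mem_nhds hV1) (j.natAbs + 1)
    refine Set.mem_iUnion.2 ⟨((n : ℤ) - j - 1).toNat, ?_⟩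
    refine ⟨a ^ n, hnV, (a ^ j)⁻¹ * x, hj, ?_⟩
    simp only
    rw [← mul_assoc, ← zpow_neg, ← zpow_natCast, ← zpow_natCast, ← zpow_add]
    congr 2
    omega
  obtain ⟨t, ht⟩ := hK.elim_finite_subcover _
    (fun m => hVo.mul_left.preimage (continuous_const_mul _)) hcover
  have hbdd : ∀ k : ℤ, a ^ k ∈ ⋃ n ∈ Set.Iic (t.sup id), (fun x => a ^ n * x) '' F := by
    intro k
    have hex : ∃ n : ℕ, a ^ (k - n) ∈ F := by
      obtain ⟨m, hm, hm'⟩ := exists_pow_mem_nhds_one hC h (inv_mem_nhds_one G hF1) k.natAbs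
      refine ⟨(k + m).toNat, ?_⟩
      rw [show k - ((k + m).toNat : ℤ) = -m by omega, zpow_neg, zpow_natCast]
      exact hm'
    classical
    have hfind := Nat.find_spec hex
    have hmin := fun m => Nat.find_min (m := m) hex
    generalize Nat.find hex = n at hfind hmin
    obtain ⟨m, hmt, hm⟩ := Set.mem_iUnion₂.1 (ht ⟨hfind, subset_closure ⟨_, rfl⟩⟩)
    -- Otherwise the return `a ^ (m + 1)` would produce a smaller `n`; this is why the exponent must
    -- be positive.
    have hnm : n ≤ m := by
      by_contra hlt
      refine hmin (n - (m + 1)) (by omega) ?_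
      have : a ^ (m + 1) * a ^ (k - n) ∈ F := hVF hm
      rwa [← zpow_natCast, ← zpow_add,
        show ((m + 1 : ℕ) : ℤ) + (k - n) = k - ((n - (m + 1) : ℕ) : ℤ) by omega] at this
    refine Set.mem_iUnion₂.2 ⟨n, hnm.trans (Finset.le_sup (f := id) hmt), _, hfind, ?_⟩
    simp only
    rw [← zpow_natCast, ← zpow_add]
    congr 1
    ring
  refine IsCompact.closure_of_subset
    ((Set.finite_Iic (t.sup id)).isCompact_biUnion fun n _ => hF.image (continuous_const_mul (a ^ n))) ?_
  rintro _ ⟨k, rfl⟩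
  exact hbdd k

/-- Right translates of a compact set by large powers of an aperiodic element avoid the set. -/
theorem IsAperiodicElement.exists_forall_mul_zpow_notMem [LocallyCompactSpace G] {a : G}
    (ha : IsAperiodicElement a) {K : Set G} (hK : IsCompact K) :
    ∃ N : ℕ, ∀ k : ℤ, N ≤ k.natAbs → ∀ x ∈ K, x * a ^ k ∉ K := by
  have hC : IsCompact (K⁻¹ * K) := hK.inv.mul hK
  have h : ¬ ∃ᶠ n : ℕ in atTop, a ^ n ∈ K⁻¹ * K := fun h => ha (isPeriodicElement_of_frequently_mem hC h)
  rw [not_frequently, eventually_atTop] at h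
  obtain ⟨N, hN⟩ := h
  refine ⟨N, fun k hk x hx hxk => hN k.natAbs hk ?_⟩
  rcases Int.natAbs_eq k with h | h
  · rw [← zpow_natCast, ← h]
    exact ⟨x⁻¹, Set.inv_mem_inv.2 hx, _, hxk, by simp⟩
  · rw [h] at hxk
    refine ⟨(x * a ^ (-(k.natAbs : ℤ)))⁻¹, Set.inv_mem_inv.2 hxk, x, hx, ?_⟩
    simp only [zpow_neg, zpow_natCast, mul_inv_rev, inv_inv, inv_mul_cancel_right]

end Aperiodic

/-! ### Construction of the function `h`. -/

section Weight

variable {G : Type*} [Group G] [TopologicalSpace G] [IsTopologicalGroup G]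
    [LocallyCompactSpace G] [SecondCountableTopology G]

/-- A bounded positive continuous function decaying summably along the orbits of an aperiodic
right translation, uniformly on compact sets. -/
theorem IsAperiodicElement.exists_summable_along_orbits {a : G} (ha : IsAperiodicElement a) :
    ∃ g : G → ℝ, Continuous g ∧ (∀ x, 0 < g x) ∧ (∀ x, g x ≤ 1) ∧
      ∀ K : Set G, IsCompact K → ∃ c : ℤ → ℝ, Summable c ∧ ∀ n, ∀ x ∈ K, g (x * a ^ n) ≤ c n := by
  let K := CompactExhaustion.choice G
  choose N hN using fun l => ha.exists_forall_mul_zpow_notMem (K.isCompact l)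
  have hχ : ∀ l, ∃ f : C(G, ℝ), Set.EqOn f 1 (K l) ∧ Set.EqOn f 0 (interior (K (l + 1)))ᶜ ∧
      ∀ x, f x ∈ Set.Icc (0 : ℝ) 1 := by
    intro l
    obtain ⟨f, h1, h2, -, h3⟩ := exists_continuous_one_zero_of_isCompact (K.isCompact l)
      isOpen_interior.isClosed_compl
      (Set.disjoint_compl_right_iff_subset.2 (K.subset_interior_succ l))
    exact ⟨f, h1, h2, h3⟩
  choose χ hχ1 hχ0 hχI using hχ
  have hgeom : HasSum (fun l : ℕ => (1 / 2 : ℝ) ^ (l + 1)) 1 := by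
    simpa [pow_succ] using hasSum_geometric_two.mul_right (1 / 2 : ℝ)
  -- The bump `χ l` lives in `K (l + 1)`. For `x ∈ K i` and `|n| ≥ N i` it can be nonzero at `x * a
  -- ^ n` only if `|n| < N (l + 1)`, and then the factor `2 ^ (-N (l + 1))` is at most `2 ^ (-|n|)`.
  let φ : ℕ → G → ℝ := fun l x => (1 / 2) ^ (l + 1) * ((1 / 2) ^ N (l + 1) * χ l x)
  have hφ0 : ∀ l x, 0 ≤ φ l x := fun l x => by
    have := (hχI l x).1
    positivity
  have hφb : ∀ l x, ∀ m ≤ N (l + 1), φ l x ≤ (1 / 2) ^ (l + 1) * (1 / 2) ^ m := by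
    intro l x m hm
    have h1 : (1 / 2 : ℝ) ^ N (l + 1) * χ l x ≤ (1 / 2) ^ N (l + 1) :=
      mul_le_of_le_one_right (by positivity) (hχI l x).2
    have h2 : (1 / 2 : ℝ) ^ N (l + 1) ≤ (1 / 2) ^ m :=
      pow_le_pow_of_le_one (by norm_num) (by norm_num) hm
    exact mul_le_mul_of_nonneg_left (h1.trans h2) (by positivity)
  have hφ1 : ∀ l x, φ l x ≤ (1 / 2) ^ (l + 1) := fun l x => by
    simpa using hφb l x 0 (Nat.zero_le _)
  have hφs : ∀ x, Summable fun l => φ l x := fun x =>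
    Summable.of_nonneg_of_le (fun l => hφ0 l x) (fun l => hφ1 l x) hgeom.summable
  refine ⟨fun x => ∑' l, φ l x, ?_, fun x => ?_, fun x => ?_, fun L hL => ?_⟩
  · refine continuous_tsum (fun l => ?_) hgeom.summable fun l x => ?_
    · have := (χ l).continuous
      fun_prop
    · rw [Real.norm_of_nonneg (hφ0 l x)]
      exact hφ1 l x
  · obtain ⟨l, hl⟩ := K.exists_mem x
    refine (hφs x).tsum_pos (fun l => hφ0 l x) l ?_
    have : χ l x = 1 := hχ1 l hl
    simp only [φ, this]
    positivity
  · exact ((hφs x).tsum_le_tsum (fun l => hφ1 l x) hgeom.summable).trans hgeom.tsum_eq.le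
  · obtain ⟨i, hi⟩ : ∃ i, L ⊆ K i := by
      obtain ⟨i, hi⟩ := hL.elim_directed_cover (fun i => interior (K i))
        (fun i => isOpen_interior)
        (fun x _ => by
          obtain ⟨i, hi⟩ := K.exists_mem x
          exact Set.mem_iUnion.2 ⟨i + 1, K.subset_interior_succ i hi⟩)
        (monotone_nat_of_le_succ fun i => interior_mono (K.subset_succ i)).directed_le
      exact ⟨i, hi.trans interior_subset⟩
    have hpow : Summable fun n : ℤ => (1 / 2 : ℝ) ^ n.natAbs :=
      summable_int_iff_summable_nat_and_neg.2
        ⟨by simpa using summable_geometric_two, by simpa using summable_geometric_two⟩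
    -- The factor `2 ^ N i` covers `|n| < N i`, where only the bound by `1` is available.
    refine ⟨fun n => 2 ^ N i * (1 / 2 : ℝ) ^ n.natAbs, hpow.mul_left _, fun n x hx => ?_⟩
    have hle : ∀ m : ℕ, (∀ l, φ l (x * a ^ n) ≤ (1 / 2) ^ (l + 1) * (1 / 2) ^ m) →
        ∑' l, φ l (x * a ^ n) ≤ (1 / 2) ^ m := by
      intro m h
      refine ((hφs _).tsum_le_tsum h (hgeom.summable.mul_right _)).trans ?_
      rw [tsum_mul_right, hgeom.tsum_eq, one_mul]
    rcases lt_or_ge n.natAbs (N i) with hn | hn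
    · refine (hle 0 fun l => hφb l _ 0 (Nat.zero_le _)).trans ?_
      have h1 : (1 / 2 : ℝ) ^ N i ≤ (1 / 2) ^ n.natAbs :=
        pow_le_pow_of_le_one (by norm_num) (by norm_num) hn.le
      calc (1 / 2 : ℝ) ^ 0 = 2 ^ N i * (1 / 2) ^ N i := by rw [← mul_pow]; norm_num
        _ ≤ _ := mul_le_mul_of_nonneg_left h1 (by positivity)
    · refine (hle n.natAbs fun l => ?_).trans
        (le_mul_of_one_le_left (by positivity) (one_le_pow₀ (by norm_num)))
      by_cases hl : x * a ^ n ∈ interior (K (l + 1))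
      · refine hφb l _ _ ?_
        by_contra hlt
        rcases le_total i (l + 1) with h | h
        · exact hN (l + 1) n (by omega) x (K.subset h (hi hx)) (interior_subset hl)
        · exact hN i n hn x (hi hx) (K.subset h (interior_subset hl))
      · have : χ l (x * a ^ n) = 0 := hχ0 l hl
        simp only [φ, this, mul_zero]
        positivity

/-- The function of `exists_summable_along_orbits` can be chosen with bounded quotients along the
translation. -/
theorem IsAperiodicElement.exists_summable_along_orbits_le {a : G} (ha : IsAperiodicElement a) :
    ∃ h : G → ℝ, Continuous h ∧ (∀ x, 0 < h x) ∧ (∀ x, h x ≤ 2 * h (x * a⁻¹)) ∧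
      ∀ K : Set G, IsCompact K → ∃ c : ℤ → ℝ, Summable c ∧ ∀ n, ∀ x ∈ K, h (x * a ^ n) ≤ c n := by
  obtain ⟨g, hgc, hg0, hg1, hgK⟩ := ha.exists_summable_along_orbits
  have hpow : Summable fun n : ℤ => (1 / 2 : ℝ) ^ n.natAbs :=
    summable_int_iff_summable_nat_and_neg.2
      ⟨by simpa using summable_geometric_two, by simpa using summable_geometric_two⟩
  have h0 : ∀ (m : ℤ) x, 0 < (1 / 2 : ℝ) ^ m.natAbs * g (x * a ^ m) := fun m x => by
    have := hg0 (x * a ^ m)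
    positivity
  have h1 : ∀ (m : ℤ) x, (1 / 2 : ℝ) ^ m.natAbs * g (x * a ^ m) ≤ (1 / 2 : ℝ) ^ m.natAbs :=
    fun m x => mul_le_of_le_one_right (by positivity) (hg1 _)
  have hs : ∀ x, Summable fun m : ℤ => (1 / 2 : ℝ) ^ m.natAbs * g (x * a ^ m) := fun x =>
    Summable.of_nonneg_of_le (fun m => (h0 m x).le) (fun m => h1 m x) hpow
  -- Moving from `x` to `x * a⁻¹` shifts `m` by one, which changes each weight `2 ^ (-|m|)` by a
  -- factor of at most `2`.
  refine ⟨fun x => ∑' m : ℤ, (1 / 2 : ℝ) ^ m.natAbs * g (x * a ^ m), ?_, fun x => ?_, fun x => ?_,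
    fun K hK => ?_⟩
  · refine continuous_tsum (fun m => by fun_prop) hpow fun m x => ?_
    rw [Real.norm_of_nonneg (h0 m x).le]
    exact h1 m x
  · exact (hs x).tsum_pos (fun m => (h0 m x).le) 0 (h0 0 x)
  · beta_reduce
    rw [← (Equiv.addRight (1 : ℤ)).tsum_eq fun m : ℤ =>
      (1 / 2 : ℝ) ^ m.natAbs * g (x * a⁻¹ * a ^ m), ← tsum_mul_left]
    have hz : ∀ m : ℤ, x * a⁻¹ * a ^ (m + 1) = x * a ^ m := fun m => by
      rw [zpow_add_one, mul_assoc, ← zpow_add_one, ← zpow_neg_one, ← zpow_add]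
      congr 2
      ring
    have hs' := (Equiv.addRight (1 : ℤ)).summable_iff.2 (hs (x * a⁻¹))
    refine (hs x).tsum_le_tsum (fun m => ?_) (hs'.mul_left 2)
    simp only [Equiv.coe_addRight, hz, ← mul_assoc]
    refine mul_le_mul_of_nonneg_right ?_ (hg0 _).le
    have : (1 / 2 : ℝ) ^ (m.natAbs + 1) ≤ (1 / 2) ^ (m + 1).natAbs :=
      pow_le_pow_of_le_one (by norm_num) (by norm_num) (by omega)
    rw [pow_succ] at this
    linarith
  · obtain ⟨c, hc, hcK⟩ := hgK K hK
    rcases K.eq_empty_or_nonempty with rfl | ⟨x₀, hx₀⟩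
    · exact ⟨fun _ => 0, summable_zero, by simp⟩
    have hc0 : ∀ n, 0 ≤ c n := fun n => (hg0 _).le.trans (hcK n x₀ hx₀)
    -- The new bound is a convolution of two summable sequences; a shear of `ℤ × ℤ` reduces it to
    -- their product.
    have hprod : Summable fun z : ℤ × ℤ => (1 / 2 : ℝ) ^ z.2.natAbs * c (z.1 + z.2) := by
      let e : ℤ × ℤ ≃ ℤ × ℤ :=
        { toFun := fun z => (z.2, z.1 + z.2)
          invFun := fun z => (z.2 - z.1, z.1)
          left_inv := fun z => by simp
          right_inv := fun z => by simp }
      have := hpow.mul_of_nonneg hc (fun n => by positivity) hc0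
      exact e.summable_iff.2 this
    refine ⟨fun n => ∑' m : ℤ, (1 / 2 : ℝ) ^ m.natAbs * c (n + m), hprod.prod, fun n x hx => ?_⟩
    refine (hs _).tsum_le_tsum (fun m => ?_) (hprod.prod_factor n)
    rw [mul_assoc x, ← zpow_add]
    exact mul_le_mul_of_nonneg_left (hcK _ x hx) (by positivity)

end Weight

/-! ### Summable orbits of the weighted translation. -/

section WeightedTranslationDynamics

variable {G : Type*} [Group G] [TopologicalSpace G] [IsTopologicalGroup G]
  [MeasurableSpace G] [BorelSpace G] (𝕜 : Type*) [RCLike 𝕜]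
  (μ : Measure G) [IsRightHaarMeasure μ] (p : ℝ≥0∞) [Fact (1 ≤ p)]

/-- If `w x = h x / h (x * a⁻¹)`, where `h` decays summably along the translates of compact sets,
then the classes of continuous functions with compact support lie on summable orbits of the
weighted translation. -/
theorem hasSummableOrbit_weightedTranslation {a : G} {w : G →ᵇ ℝ} {h : G → ℝ} (hc : Continuous h)
    (h0 : ∀ x, 0 < h x) (hw : ∀ x, w x = h x / h (x * a⁻¹))
    (hK : ∀ K : Set G, IsCompact K →
      ∃ c : ℤ → ℝ, Summable c ∧ ∀ n, ∀ x ∈ K, h (x * a ^ n) ≤ c n)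
    {g : G → 𝕜} (hg : Continuous g) (hgs : HasCompactSupport g) (hgp : MemLp g p μ) :
    HasSummableOrbit (weightedTranslation 𝕜 μ p a w) (hgp.toLp g) := by
  obtain ⟨c, hcs, hcK⟩ := hK _ hgs
  obtain ⟨b, hb⟩ := hgs.isCompact.exists_bound_of_continuousOn
    (f := fun x => (h x)⁻¹) (hc.inv₀ fun x => (h0 x).ne').continuousOn
  -- This is the conjugated translate `h · (g / h)(· a⁻ⁿ)`. Where it is nonzero, `x * a ^ (-n)` lies
  -- in the support of `g`, so the numerator is at most `c n` and the inverse denominator at most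
  -- `b`.
  let v : ℤ → G → 𝕜 := fun n x => ((h x / h (x * a ^ (-n)) : ℝ) : 𝕜) * g (x * a ^ (-n))
  have hvc : ∀ n, Continuous (v n) := fun n => by
    have h1 : Continuous fun x => h x / h (x * a ^ (-n)) :=
      hc.div (by fun_prop) fun x => (h0 _).ne'
    exact (RCLike.continuous_ofReal.comp h1).mul (by fun_prop)
  have hvb : ∀ n x, ‖v n x‖ ≤ c n * b * ‖g (x * a ^ (-n))‖ := by
    intro n x
    by_cases hx : x * a ^ (-n) ∈ tsupport g
    · have h1 := hcK n _ hx
      have h2 := hb _ hx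
      rw [zpow_neg, inv_mul_cancel_right] at h1
      simp only [v]
      rw [norm_mul, RCLike.norm_ofReal, div_eq_mul_inv, abs_mul, abs_of_pos (h0 x)]
      have h3 : (0 : ℝ) ≤ c n := (h0 x).le.trans h1
      gcongr
      exact h2
    · simp only [v, image_eq_zero_of_notMem_tsupport hx, mul_zero, norm_zero, le_refl]
  have hmp : ∀ n : ℤ, MeasurePreserving (fun x => x * a ^ (-n)) μ μ := fun n =>
    measurePreserving_mul_right μ _
  have hvp : ∀ n, MemLp (v n) p μ := fun n =>
    (hgp.comp_measurePreserving (hmp n)).of_le_mul (hvc n).aestronglyMeasurable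
      (Eventually.of_forall (hvb n))
  refine ⟨fun n => (hvp n).toLp (v n), ?_, fun n => ?_, ?_⟩
  · refine MemLp.toLp_congr _ _ (Eventually.of_forall fun x => ?_)
    simp [v, (h0 x).ne']
  · refine Lp.ext ((coeFn_weightedTranslation 𝕜 μ p a w _).trans ?_)
    filter_upwards [(measurePreserving_mul_right μ a⁻¹).quasiMeasurePreserving.ae
      (MemLp.coeFn_toLp (hvp n)), MemLp.coeFn_toLp (hvp (n + 1))] with x hx hx'
    rw [hx, hx', hw]
    have hz : x * a⁻¹ * a ^ (-n) = x * a ^ (-(n + 1)) := by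
      rw [mul_assoc, ← zpow_neg_one, ← zpow_add]
      congr 2
      ring
    simp only [v, hz]
    rw [← mul_assoc, ← RCLike.ofReal_mul, div_mul_div_cancel₀ (h0 _).ne']
  · refine Summable.of_nonneg_of_le (fun n => norm_nonneg _) (fun n => ?_)
      ((hcs.mul_right b).mul_right ‖hgp.toLp g‖)
    have h1 : ‖Lp.compMeasurePreserving _ (hmp n) (hgp.toLp g)‖ = ‖hgp.toLp g‖ :=
      Lp.norm_compMeasurePreserving _ (hmp n)
    rw [← h1]
    refine Lp.norm_le_mul_norm_of_ae_le_mul ?_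
    filter_upwards [MemLp.coeFn_toLp (hvp n),
      Lp.coeFn_compMeasurePreserving (hgp.toLp g) (hmp n),
      (hmp n).quasiMeasurePreserving.ae (MemLp.coeFn_toLp hgp)] with x h2 h3 h4
    rw [h2, h3, Function.comp_apply, h4]
    exact hvb n x

theorem dense_summableOrbit_weightedTranslation [LocallyCompactSpace G]
    [SecondCountableTopology G] (hp : p ≠ ∞) {a : G} {w : G →ᵇ ℝ} {h : G → ℝ} (hc : Continuous h)
    (h0 : ∀ x, 0 < h x) (hw : ∀ x, w x = h x / h (x * a⁻¹))
    (hK : ∀ K : Set G, IsCompact K →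
      ∃ c : ℤ → ℝ, Summable c ∧ ∀ n, ∀ x ∈ K, h (x * a ^ n) ≤ c n) :
    Dense {f | HasSummableOrbit (weightedTranslation 𝕜 μ p a w) f} := by
  intro f
  rw [EMetric.mem_closure_iff]
  intro ε hε
  obtain ⟨δ, hδ, hδε⟩ := exists_between hε
  obtain ⟨g, hgs, hfg, hg, hgp⟩ := (Lp.memLp f).exists_hasCompactSupport_eLpNorm_sub_le hp hδ.ne'
  refine ⟨_, hasSummableOrbit_weightedTranslation 𝕜 μ p hc h0 hw hK hg hgs hgp, ?_⟩
  rw [Lp.edist_def]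
  refine lt_of_le_of_lt (le_of_eq_of_le (eLpNorm_congr_ae ?_) hfg) hδε
  filter_upwards [MemLp.coeFn_toLp hgp] with x hx
  simp [hx]

end WeightedTranslationDynamics

theorem mainTheorem1 {G : Type*} [Group G] [TopologicalSpace G] [IsTopologicalGroup G]
    [LocallyCompactSpace G] [SecondCountableTopology G] [MeasurableSpace G] [BorelSpace G]
    (𝕜 : Type*) [RCLike 𝕜] (μ : Measure G) [IsRightHaarMeasure μ]
    (a : G) (ha : IsAperiodicElement a) :
    ∃ w : G →ᵇ ℝ, (∀ x : G, 0 < w x) ∧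
      ∀ (p : ℝ≥0∞) [Fact (1 ≤ p)], p ≠ ∞ →
        IsMixingOp (weightedTranslation 𝕜 μ p a w) ∧
        IsChaoticOp (weightedTranslation 𝕜 μ p a w) ∧
        IsFrequentlyHypercyclicOp (weightedTranslation 𝕜 μ p a w) := by
  obtain ⟨h, hc, h0, h2, hK⟩ := ha.exists_summable_along_orbits_le
  have hwc : Continuous fun x => h x / h (x * a⁻¹) := hc.div (by fun_prop) fun x => (h0 _).ne'
  let w : G →ᵇ ℝ := BoundedContinuousFunction.ofNormedAddCommGroup _ hwc 2 fun x => by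
    rw [Real.norm_of_nonneg (div_pos (h0 _) (h0 _)).le, div_le_iff₀ (h0 _)]
    exact h2 x
  refine ⟨w, fun x => div_pos (h0 _) (h0 _), fun p _ hp => ?_⟩
  -- This gives the second countability of `Lᵖ` needed for a dense sequence.
  have : Fact (p ≠ ∞) := ⟨hp⟩
  have hD := dense_summableOrbit_weightedTranslation 𝕜 μ p hp (w := w) hc h0 (fun _ => rfl) hK
  have hF := isFrequentlyHypercyclicOp_of_dense_summableOrbit hD
  exact ⟨isMixingOp_of_dense_summableOrbit hD,
    ⟨hF.isHypercyclicOp, dense_periodicPts_of_dense_summableOrbit hD⟩, hF⟩
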